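/- Let $k$ be an arbitrary field of positive characteristic $p$, let $W$ be a complete discrete valuation ring of characteristic $0$ with residue field $k$, and let $G$ be a finite group. Let $R$ denote $k$ or $W$. An $RG$-module $M$ that is finitely generated and free over $R$ is called *endo-trivial* if $\mathrm{End}_R(M)$, with $G$ acting by conjugation, is isomorphic as an $RG$-module to $R\oplus P$, where $R$ carries the trivial $G$-action and $P$ is a projective $RG$-module. If $V$ is a finitely generated endo-trivial $kG$-module, then $V$ can be lifted to an endo-trivial $WG$-module: there is a finitely generated $WG$-module $V_W$, free over $W$, such that $k\otimes_W V_W\cong V$ as $kG$-modules and $V_W$ is endo-trivial. -/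

import Mathlib

open scoped TensorProduct MonoidAlgebra

universe u v w x

noncomputable section

/-- A representation of `G` on a module `M` that is finitely generated and free over the
commutative ring `R` (for `G` finite and `R` a field: a finitely generated `RG`-module; in general
an `RG`-lattice) is endo-trivial if `End_R(M)`, with `G` acting by conjugation, is isomorphic as an
`RG`-module to the direct sum of the trivial module `R` and a projective `RG`-module `P`.
As `P` embeds in `End_R(M)`, nothing is lost by taking `P` in the universe of `M`. -/
def IsEndoTrivial {R : Type u} {G : Type w} {M : Type x} [CommRing R] [Group G]
    [AddCommGroup M] [Module R M] (σ : Representation R G M) : Prop :=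
  Module.Finite R M ∧ Module.Free R M ∧
    ∃ (P : Type x) (_ : AddCommGroup P) (_ : Module R[G] P),
      Module.Projective R[G] P ∧
        Nonempty ((σ.linHom σ).asModule ≃ₗ[R[G]] ((Representation.trivial R G R).asModule × P))

/-- The representation of `G` on `k ⊗ M` obtained from one on the `W`-module `M` by extension of
scalars from `W` to `k`. -/
def baseChangeRep {W : Type*} (k : Type*) {G : Type*} {M : Type*} [CommRing W] [CommRing k]
    [Algebra W k] [Group G] [AddCommGroup M] [Module W M] (σ : Representation W G M) :
    Representation k G (k ⊗[W] M) where
  toFun g := (σ g).baseChange k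
  map_one' := by rw [map_one]; exact LinearMap.baseChange_id
  map_mul' g h := by rw [map_mul]; exact LinearMap.baseChange_comp _ _

/-- `σ` is (the module part of) a lift of the `kG`-module `ρ` over `W`: it is a finitely generated
`WG`-module, free over `W`, whose reduction `k ⊗ M` is isomorphic to `ρ` as a `kG`-module. -/
def IsLiftOf {W k G M V : Type*} [CommRing W] [CommRing k] [Algebra W k] [Group G]
    [AddCommGroup M] [Module W M] [AddCommGroup V] [Module k V]
    (σ : Representation W G M) (ρ : Representation k G V) : Prop :=
  Module.Finite W M ∧ Module.Free W M ∧
    Nonempty ((baseChangeRep k σ).asModule ≃ₗ[k[G]] ρ.asModule)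

end

/-! Projectivity is handled by Higman's criterion: an `R`-projective module is projective over
`R[G]` exactly when its identity has the form `∑ g, g θ g⁻¹` for an `R`-linear `θ`; such sums are
`conjSum`.

If `|G| ≠ 0` in `k`, then `θ = |G|⁻¹` always works. If `|G| = 0` in `k`, taking traces on `End V` in
the endo-trivial splitting gives `(dim V)² = 1` in `k`. So the trace divided by `dim V` splits off
the scalars, and `exists_conjSum_eq_sub`, in place of Krull–Schmidt, shows that the identity on
trace-zero endomorphisms is a sum of conjugates.

To lift `V`, the character `det` is lifted to a character `l` of `W` by Hensel's lemma
(`exists_monoidHom_lift`). Matrices are then lifted modulo successive powers of `ϖ` with determinant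
exactly `l` (`exists_lift_step`). This forces the obstruction cocycle into the trace-zero matrices,
where second cohomology vanishes; the trivial summand, whose cohomology need not vanish, never
enters. Completeness gives the limit. Finally `exists_conjSum_lift` carries the operator `θ` from
`k` to `W` by Nakayama's lemma, so the lift is endo-trivial. -/

/-! ### Conjugation action on an algebra -/

/-- Conjugation by `f g` on the algebra `A`, for a monoid homomorphism `f : G →* A`. -/
def conjBy (R : Type*) {G A : Type*} [CommSemiring R] [Group G] [Semiring A] [Algebra R A]
    (f : G →* A) : Representation R G A where
  toFun g := LinearMap.mulLeft R (f g) ∘ₗ LinearMap.mulRight R (f g⁻¹)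
  map_one' := by ext; simp
  map_mul' g h := by ext; simp [mul_assoc]

theorem conjBy_apply {R G A : Type*} [CommSemiring R] [Group G] [Semiring A] [Algebra R A]
    (f : G →* A) (g : G) (x : A) : conjBy R f g x = f g * x * f g⁻¹ := by
  simp [conjBy, mul_assoc]

theorem conjBy_one {R G A : Type*} [CommSemiring R] [Group G] [Semiring A] [Algebra R A]
    (f : G →* A) (g : G) : conjBy R f g 1 = 1 := by
  simp [conjBy_apply, ← map_mul]

theorem conjBy_eq_linHom {R G V : Type*} [CommSemiring R] [Group G] [AddCommMonoid V] [Module R V]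
    (ρ : Representation R G V) : ρ.linHom ρ = conjBy R (A := Module.End R V) ρ := by
  ext g x v
  simp [conjBy_apply]

/-! ### Sums of conjugates and change of trivial summand -/

section ConjSum

variable {R G A : Type*} [CommRing R] [Group G] [Fintype G] [AddCommGroup A] [Module R A]

/-- The sum of the `G`-conjugates of a linear endomorphism of a representation. -/
def conjSum (τ : Representation R G A) (θ : A →ₗ[R] A) : A →ₗ[R] A :=
  ∑ g : G, τ g ∘ₗ θ ∘ₗ τ g⁻¹

theorem conjSum_apply (τ : Representation R G A) (θ : A →ₗ[R] A) (x : A) :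
    conjSum τ θ x = ∑ g : G, τ g (θ (τ g⁻¹ x)) := by
  simp [conjSum]

theorem conjSum_comm (τ : Representation R G A) (θ : A →ₗ[R] A) (h : G) (x : A) :
    conjSum τ θ (τ h x) = τ h (conjSum τ θ x) := by
  simp only [conjSum_apply, map_sum]
  refine Fintype.sum_bijective (h⁻¹ * ·) (Group.mulLeft_bijective h⁻¹) _ _ fun g ↦ ?_
  simp only [← Module.End.mul_apply, ← mul_assoc, ← map_mul]
  simp [mul_assoc]

theorem conjSum_comp_right (τ : Representation R G A) (θ φ : A →ₗ[R] A)
    (hφ : ∀ g x, φ (τ g x) = τ g (φ x)) : conjSum τ (θ ∘ₗ φ) = conjSum τ θ ∘ₗ φ := by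
  ext x
  simp [conjSum_apply, hφ]

theorem conjSum_comp_left (τ : Representation R G A) (θ φ : A →ₗ[R] A)
    (hφ : ∀ g x, φ (τ g x) = τ g (φ x)) : conjSum τ (φ ∘ₗ θ) = φ ∘ₗ conjSum τ θ := by
  ext x
  simp [conjSum_apply, hφ]

theorem conjSum_add (τ : Representation R G A) (θ φ : A →ₗ[R] A) :
    conjSum τ (θ + φ) = conjSum τ θ + conjSum τ φ := by
  ext x
  simp [conjSum_apply, Finset.sum_add_distrib]

theorem trace_conjSum [Module.Free R A] [Module.Finite R A] (τ : Representation R G A) (θ : A →ₗ[R] A) :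
    LinearMap.trace R A (conjSum τ θ) = Fintype.card G * LinearMap.trace R A θ := by
  have (g : G) : LinearMap.trace R A (τ g ∘ₗ θ ∘ₗ τ g⁻¹) = LinearMap.trace R A θ := by
    rw [LinearMap.trace_comp_comm', LinearMap.comp_assoc, ← Module.End.mul_eq_comp (τ g⁻¹),
      ← map_mul, inv_mul_cancel, map_one]
    rfl
  simp [conjSum, map_sum, this]

/-- If `R·z` splits off a representation with complement on which the identity is a sum of
conjugates, and `|G| = 0` in `R`, then every split trivial submodule `R·e` has a complement with
the same property. -/
theorem exists_conjSum_eq_sub (τ : Representation R G A) (hG : (Fintype.card G : R) = 0)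
    {z : A} (hz : ∀ g, τ g z = z) {π : A →ₗ[R] R} (hπ : ∀ g x, π (τ g x) = π x) (hπz : π z = 1)
    {θ : A →ₗ[R] A} (hθ : ∀ x, x = π x • z + conjSum τ θ x)
    {e : A} (he : ∀ g, τ g e = e) {r : A →ₗ[R] R} (hr : ∀ g x, r (τ g x) = r x) (hre : r e = 1) :
    ∃ θ' : A →ₗ[R] A, ∀ x, conjSum τ θ' x = x - r x • e := by
  -- Apply `r` to the splitting of `e`: the sum of conjugates contributes `|G| * r (θ e) = 0`.
  have key : π e * r z = 1 := by
    have h := congrArg r (hθ e)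
    have h0 : r (conjSum τ θ e) = 0 := by
      simp [conjSum_apply, hr, he, hG]
    rw [map_add, h0, hre, map_smul, add_zero, smul_eq_mul] at h
    exact h.symm
  set q : A →ₗ[R] A := LinearMap.id - r.smulRight e with hq
  have hqa (x) : q x = x - r x • e := by simp [hq]
  have hqc (g x) : q (τ g x) = τ g (q x) := by simp [hqa, hr, he]
  have hqz : q z = conjSum τ θ (q z) := by
    have h := hθ (q z)
    have : π (q z) = 0 := by simp [hqa, hπz, mul_comm (r z), key]
    rwa [this, zero_smul, zero_add] at h
  -- By `hqz` the two terms give `π x • q z` and `q (conjSum τ θ x)`, which add up to `q x`.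
  refine ⟨θ ∘ₗ π.smulRight (q z) + q ∘ₗ θ, fun x ↦ ?_⟩
  rw [conjSum_add, conjSum_comp_left _ _ _ hqc, conjSum_comp_right _ _ _ (fun g x ↦ by
    simp [hπ, ← hqc, hz]), ← hqa]
  conv_rhs => rw [hθ x, map_add, map_smul, hqz]
  simp

end ConjSum

/-! ### Higman's criterion -/

section Projective

variable {R G P : Type*} [CommRing R] [Group G] [Fintype G] [AddCommGroup P] [Module R[G] P]
  [Module R P] [IsScalarTower R R[G] P]

/-- On a projective `R[G]`-module the identity is a sum of `G`-conjugates. -/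
theorem Module.Projective.exists_sum_conj_eq [Module.Projective R[G] P] :
    ∃ θ : P →ₗ[R] P, ∀ y : P, ∑ g : G, MonoidAlgebra.single g (1 : R) •
      θ (MonoidAlgebra.single g⁻¹ (1 : R) • y) = y := by
  obtain ⟨s, hs⟩ := Module.projective_def'.1 ‹Module.Projective R[G] P›
  -- The coefficient at `1`; its translates read off all coefficients, so on a free module the
  -- identity is a sum of conjugates. The section `s` transfers this to `P`.
  let η : R[G] →ₗ[R] R := Finsupp.lapply 1 ∘ₗ (MonoidAlgebra.coeffLinearEquiv R).toLinearMap
  have hη (g : G) (a : R[G]) : η (MonoidAlgebra.single g⁻¹ (1 : R) * a) = a.coeff g := by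
    rw [← one_mul (a.coeff g)]
    exact MonoidAlgebra.coeff_single_mul_eq_mul_coeff _ fun h _ ↦ inv_mul_eq_one.trans eq_comm
  have hsum (a : R[G]) : ∑ g : G, MonoidAlgebra.single g (a.coeff g) = a := by
    ext h
    simp [MonoidAlgebra.coeff_sum]
  have key (F : P →₀ R[G]) : ∑ g : G, MonoidAlgebra.single g (1 : R) •
      Finsupp.linearCombination R id (Finsupp.mapRange.linearMap η
        (MonoidAlgebra.single g⁻¹ (1 : R) • F)) = Finsupp.linearCombination R[G] id F := by
    induction F using Finsupp.induction_linear with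
    | zero => simp
    | add F F' hF hF' => simp only [smul_add, map_add, Finset.sum_add_distrib, hF, hF']
    | single y a =>
      simp only [Finsupp.smul_single, Finsupp.mapRange.linearMap_apply, Finsupp.mapRange_single,
        Finsupp.linearCombination_single, id, smul_eq_mul, hη]
      conv_rhs => rw [← hsum a, Finset.sum_smul]
      refine Finset.sum_congr rfl fun g _ ↦ ?_
      rw [← smul_one_smul R[G] (a.coeff g) y, smul_smul]
      simp [MonoidAlgebra.one_def]
  refine ⟨Finsupp.linearCombination R id ∘ₗ Finsupp.mapRange.linearMap η ∘ₗ
    s.restrictScalars R, fun y ↦ ?_⟩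
  simp only [LinearMap.comp_apply, LinearMap.restrictScalars_apply, map_smul]
  rw [key, ← LinearMap.comp_apply, hs, LinearMap.id_apply]

/-- A representation on which the identity is a sum of conjugates, and which is projective over
the coefficient ring, is projective over the group algebra. -/
theorem Module.Projective.of_sum_conj_eq [Module.Projective R P] (θ : P →ₗ[R] P)
    (hθ : ∀ y : P, ∑ g : G, MonoidAlgebra.single g (1 : R) •
      θ (MonoidAlgebra.single g⁻¹ (1 : R) • y) = y) : Module.Projective R[G] P := by
  obtain ⟨s, hs⟩ := Module.projective_lifting_property
    ((Finsupp.linearCombination R[G] (id : P → P)).restrictScalars R) (LinearMap.id)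
    (Finsupp.linearCombination_id_surjective R[G] P)
  -- Averaging `s ∘ₗ θ` makes it equivariant; composed with the equivariant projection it becomes
  -- the sum of conjugates of `θ`.
  refine Module.Projective.of_split ((s ∘ₗ θ).sumOfConjugatesEquivariant G)
    (Finsupp.linearCombination R[G] (id : P → P)) ?_
  ext y
  have hs' (y : P) : Finsupp.linearCombination R[G] (id : P → P) (s y) = y :=
    LinearMap.congr_fun hs y
  simp only [LinearMap.comp_apply, LinearMap.sumOfConjugatesEquivariant_apply, map_sum,
    LinearMap.conjugate_apply, map_smul, hs', LinearMap.id_apply]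
  conv_rhs => rw [← hθ y]
  exact Fintype.sum_equiv (Equiv.inv G) _ _ fun g ↦ by simp

end Projective

/-! ### Endo-triviality in terms of sums of conjugates -/

section EndoTrivial

theorem Representation.asModuleEquiv_single_smul {R G V : Type*} [CommSemiring R] [Monoid G]
    [AddCommMonoid V] [Module R V] (τ : Representation R G V) (g : G) (x : τ.asModule) :
    τ.asModuleEquiv (MonoidAlgebra.single g (1 : R) • x) = τ g (τ.asModuleEquiv x) := by
  rw [asModuleEquiv_map_smul, asAlgebraHom_single_one]

variable {R : Type u} {G : Type w} {M : Type x} [CommRing R] [Group G] [Fintype G]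
  [AddCommGroup M] [Module R M]

/-- The splitting of the endomorphism ring of an endo-trivial module in terms of sums of
conjugates. -/
theorem IsEndoTrivial.exists_splitting {σ : Representation R G M} (h : IsEndoTrivial σ) :
    ∃ (z : Module.End R M) (π : Module.End R M →ₗ[R] R)
      (θ : Module.End R M →ₗ[R] Module.End R M),
      (∀ g, conjBy R σ g z = z) ∧ (∀ g x, π (conjBy R σ g x) = π x) ∧ π z = 1 ∧
      ∀ x, x = π x • z + conjSum (conjBy R σ) θ x := by
  obtain ⟨-, -, P, _, _, hP, ⟨Φ⟩⟩ := h
  let _ : Module R P := Module.compHom P (algebraMap R R[G])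
  have : IsScalarTower R R[G] P := IsScalarTower.of_algebraMap_smul fun _ _ ↦ rfl
  obtain ⟨θ, hθ⟩ := Module.Projective.exists_sum_conj_eq (R := R) (G := G) (P := P)
  let Ψ : Module.End R M ≃ₗ[R] R × P := (σ.linHom σ).asModuleEquiv.symm.trans
    ((Φ.restrictScalars R).trans
      (LinearEquiv.prodCongr (Representation.trivial R G R).asModuleEquiv (.refl R P)))
  have hΨ (g : G) (x : Module.End R M) :
      Ψ (conjBy R σ g x) = ((Ψ x).1, MonoidAlgebra.single g (1 : R) • (Ψ x).2) := by
    have h := Φ.map_smul (MonoidAlgebra.single g (1 : R)) ((σ.linHom σ).asModuleEquiv.symm x)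
    rw [← conjBy_eq_linHom]
    simp only [Ψ, LinearEquiv.trans_apply, Representation.asModuleEquiv_symm_map_rho,
      MonoidAlgebra.of_apply, LinearEquiv.restrictScalars_apply, h]
    ext
    · simp only [LinearEquiv.prodCongr_apply, Prod.smul_fst,
        Representation.asModuleEquiv_single_smul, Representation.isTrivial_def, LinearMap.id_apply]
    · simp
  refine ⟨Ψ.symm (1, 0), LinearMap.fst R R P ∘ₗ Ψ.toLinearMap,
    Ψ.symm.toLinearMap ∘ₗ LinearMap.inr R R P ∘ₗ θ ∘ₗ LinearMap.snd R R P ∘ₗ Ψ.toLinearMap,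
    fun g ↦ Ψ.injective ?_, fun g x ↦ ?_, ?_, fun x ↦ Ψ.injective ?_⟩
  · simp [hΨ]
  · simp [hΨ]
  · simp
  · simp only [conjSum_apply, map_add, map_sum, map_smul, hΨ]
    ext
    · simp [Prod.fst_sum]
    · simp [Prod.snd_sum, hΨ, hθ]

/-- A lattice is endo-trivial if its endomorphism ring has an equivariant retraction onto the
scalars on whose kernel the identity is a sum of conjugates. -/
theorem isEndoTrivial_of_retraction [Module.Finite R M] [Module.Free R M]
    (σ : Representation R G M) (r : Module.End R M →ₗ[R] R)
    (hr : ∀ g x, r (conjBy R σ g x) = r x) (hr1 : r 1 = 1)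
    (θ : Module.End R M →ₗ[R] Module.End R M)
    (hθ : ∀ x, r x = 0 → conjSum (conjBy R σ) θ x = x) : IsEndoTrivial σ := by
  let E := (σ.linHom σ).asModuleEquiv
  have hE (g : G) (x : (σ.linHom σ).asModule) :
      E (MonoidAlgebra.single g (1 : R) • x) = conjBy R σ g (E x) := by
    rw [← conjBy_eq_linHom]
    exact Representation.asModuleEquiv_single_smul _ g x
  let ρ : (σ.linHom σ).asModule →ₗ[R[G]] (Representation.trivial R G R).asModule :=
    MonoidAlgebra.equivariantOfLinearOfComm
      ((Representation.trivial R G R).asModuleEquiv.symm.toLinearMap ∘ₗ r ∘ₗ E.toLinearMap) (by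
        intro g x
        refine (Representation.trivial R G R).asModuleEquiv.injective ?_
        rw [Representation.asModuleEquiv_single_smul]
        simp [-Representation.single_smul, hE, hr])
  let ι : (Representation.trivial R G R).asModule →ₗ[R[G]] (σ.linHom σ).asModule :=
    MonoidAlgebra.equivariantOfLinearOfComm
      (E.symm.toLinearMap ∘ₗ LinearMap.toSpanSingleton R (Module.End R M) 1 ∘ₗ
        (Representation.trivial R G R).asModuleEquiv.toLinearMap) (by
        intro g x
        refine E.injective ?_
        simp only [LinearMap.comp_apply, LinearEquiv.coe_coe,
          Representation.asModuleEquiv_single_smul, hE, LinearEquiv.apply_symm_apply,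
          LinearMap.toSpanSingleton_apply, map_smul, conjBy_one, Representation.isTrivial_def,
          LinearMap.id_apply])
  have hρι (t) : ρ (ι t) = t := by
    refine (Representation.trivial R G R).asModuleEquiv.injective ?_
    simp [ρ, ι, hr1]
  have hρ (x) (hx : ρ x = 0) : r (E x) = 0 := by
    have := congrArg (Representation.trivial R G R).asModuleEquiv hx
    simpa [ρ] using this
  let q : (σ.linHom σ).asModule →ₗ[R[G]] LinearMap.ker ρ :=
    (LinearMap.id - ι ∘ₗ ρ).codRestrict _ fun x ↦ by simp [hρι]
  have hq (x) : ((q x : LinearMap.ker ρ) : (σ.linHom σ).asModule) = x - ι (ρ x) := rfl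
  have hq' (x : LinearMap.ker ρ) : q x = x := by
    ext1
    rw [hq, LinearMap.mem_ker.1 x.2, map_zero, sub_zero]
  let Φ : (σ.linHom σ).asModule ≃ₗ[R[G]]
      (Representation.trivial R G R).asModule × LinearMap.ker ρ :=
    LinearEquiv.ofLinearMap (ρ.prod q) (ι.coprod (LinearMap.ker ρ).subtype)
      (by
        ext x
        · simp [hρι]
        · simp [hρι, hq]
        · simp
        · simp [hq'])
      (by ext x; simp [hq])
  have hproj : Module.Projective R (LinearMap.ker ρ) := by
    have : Module.Projective R (σ.linHom σ).asModule := Module.Projective.of_equiv E.symm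
    exact Module.Projective.of_split ((LinearMap.ker ρ).subtype.restrictScalars R)
      (q.restrictScalars R) (by ext1 x; exact hq' x)
  refine ⟨inferInstance, inferInstance, LinearMap.ker ρ, inferInstance, inferInstance,
    Module.Projective.of_sum_conj_eq (q.restrictScalars R ∘ₗ E.symm.toLinearMap ∘ₗ θ ∘ₗ
      E.toLinearMap ∘ₗ (LinearMap.ker ρ).subtype.restrictScalars R) fun y ↦ ?_, ⟨Φ⟩⟩
  have := hθ (E y) (hρ y y.2)
  rw [conjSum_apply] at this
  simp only [LinearMap.comp_apply, LinearMap.restrictScalars_apply, ← map_smul, ← map_sum]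
  conv_rhs => rw [← hq' y, ← E.symm_apply_apply (y : (σ.linHom σ).asModule), ← this]
  congr 1
  refine E.injective ?_
  simp only [map_sum, hE, LinearEquiv.coe_coe, LinearEquiv.apply_symm_apply,
    Submodule.subtype_apply, Submodule.coe_smul]

end EndoTrivial

/-! ### Vanishing of second cohomology -/

/-- The averaging formula for a primitive of a 2-cocycle whose values are fixed by a sum of
conjugates. -/
theorem twoCocycle_eq_coboundary {R G A : Type*} [CommRing R] [Group G] [Fintype G]
    [AddCommGroup A] [Module R A] (τ : Representation R G A) (θ : A →ₗ[R] A) (c : G → G → A)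
    (hc : ∀ g h k, τ g (c h k) + c g (h * k) = c (g * h) k + c g h)
    (hθ : ∀ g h, conjSum τ θ (c g h) = c g h) (b : G → A)
    (hb : ∀ g, b g = ∑ k, τ (g * k) (θ (τ (g * k)⁻¹ (c g k)))) (g h : G) :
    τ g (b h) + b g = b (g * h) + c g h := by
  -- All terms are rewritten as sums of conjugates by `g * h * k`, so that the cocycle identity
  -- applies summand by summand.
  have h1 : τ g (b h) = ∑ k, τ (g * h * k) (θ (τ (g * h * k)⁻¹ (τ g (c h k)))) := by
    rw [hb, map_sum]
    refine Finset.sum_congr rfl fun k _ ↦ ?_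
    have (y : A) : τ (g * h * k)⁻¹ (τ g y) = τ (h * k)⁻¹ y := by
      rw [← Module.End.mul_apply, ← map_mul]
      simp [mul_assoc]
    rw [this, ← Module.End.mul_apply (τ g), ← map_mul, mul_assoc]
  have h2 : b g = ∑ k, τ (g * h * k) (θ (τ (g * h * k)⁻¹ (c g (h * k)))) := by
    rw [hb]
    exact (Fintype.sum_equiv (Equiv.mulLeft h) _ _ fun k ↦ by simp [mul_assoc]).symm
  have h3 : c g h = ∑ k, τ (g * h * k) (θ (τ (g * h * k)⁻¹ (c g h))) := by
    conv_lhs => rw [← hθ, conjSum_apply]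
    exact (Fintype.sum_equiv (Equiv.mulLeft (g * h)) _ _ fun k ↦ by simp [mul_assoc]).symm
  conv_rhs => rw [h3]
  rw [h1, h2, hb (g * h), ← Finset.sum_add_distrib, ← Finset.sum_add_distrib]
  simp_rw [← map_add, hc]

/-! ### Lifting characters by roots of unity -/

section Teichmuller

variable {W k : Type*} [CommRing W] [Field k] [Algebra W k] [IsLocalHom (algebraMap W k)]

/-- In `x ^ m - y ^ m = (∑ x ^ i y ^ (m-1-i)) (x - y)` the sum reduces to `m y ^ (m-1) ≠ 0`, hence
is a unit. This uniqueness makes the chosen root lifts multiplicative. -/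
theorem eq_of_pow_eq_one_of_map_eq {m : ℕ} (hm : (m : k) ≠ 0) {x y : W} (hx : x ^ m = 1)
    (hy : y ^ m = 1) (h : algebraMap W k x = algebraMap W k y) : x = y := by
  have hm0 : m ≠ 0 := by rintro rfl; simp at hm
  have hgeom : (∑ i ∈ Finset.range m, x ^ i * y ^ (m - 1 - i)) * (x - y) = 0 := by
    rw [(Commute.all x y).geom_sum₂_mul, hx, hy, sub_self]
  have hu : IsUnit (∑ i ∈ Finset.range m, x ^ i * y ^ (m - 1 - i)) := by
    refine isUnit_of_map_unit (algebraMap W k) _ (IsUnit.mk0 _ ?_)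
    have hy0 : algebraMap W k y ≠ 0 := by
      intro h0
      have := congrArg (algebraMap W k) hy
      simp [h0, hm0] at this
    rw [map_sum, Finset.sum_congr rfl (g := fun _ ↦ algebraMap W k y ^ (m - 1))]
    · simp [hm, hy0]
    · intro i hi
      rw [map_mul, map_pow, map_pow, h, ← pow_add]
      congr 1
      have := Finset.mem_range.1 hi
      omega
  exact sub_eq_zero.1 ((hu.mul_right_eq_zero).1 hgeom)

/-- A character of a finite group with values in the residue field of a Henselian ring lifts. -/
theorem exists_monoidHom_lift {p : ℕ} [CharP k p] (hp : p.Prime) [IsLocalRing W]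
    [HenselianRing W (IsLocalRing.maximalIdeal W)]
    (hres : Function.Surjective (algebraMap W k)) {G : Type*} [Group G] [Finite G] (χ : G →* k) :
    ∃ l : G →* W, ∀ g, algebraMap W k (l g) = χ g := by
  have hmem (x : W) : x ∈ IsLocalRing.maximalIdeal W ↔ algebraMap W k x = 0 := by
    rw [IsLocalRing.mem_maximalIdeal, mem_nonunits_iff, ← isUnit_map_iff (algebraMap W k),
      isUnit_iff_ne_zero, not_not]
  obtain ⟨a, m, hpm, hcard⟩ := Nat.exists_eq_pow_mul_and_not_dvd
    (Nat.card_pos (α := G)).ne' p hp.ne_one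
  have hm : (m : k) ≠ 0 := by rwa [Ne, CharP.cast_eq_zero_iff k p]
  have hm0 : m ≠ 0 := by rintro rfl; simp at hm
  have : Fact p.Prime := ⟨hp⟩
  -- Here `m` is the prime-to-`p` part of `|G|`; a field of characteristic `p` has no nontrivial
  -- `p`-power roots of unity.
  have hχ (g : G) : χ g ^ m = 1 := by
    have h : (χ g ^ m) ^ p ^ a = 1 := by
      rw [← pow_mul, mul_comm, ← hcard, ← map_pow, pow_card_eq_one', map_one]
    have h' : (χ g ^ m - 1) ^ p ^ a = 0 := by rw [sub_pow_char_pow, h, one_pow, sub_self]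
    exact sub_eq_zero.1 (eq_zero_of_pow_eq_zero h')
  have hex (g : G) : ∃ x : W, x ^ m = 1 ∧ algebraMap W k x = χ g := by
    obtain ⟨a₀, ha₀⟩ := hres (χ g)
    have hχ0 : χ g ≠ 0 := fun h ↦ by simpa [h, hm0] using hχ g
    obtain ⟨x, hx, hxa⟩ := HenselianRing.is_henselian (I := IsLocalRing.maximalIdeal W)
      (Polynomial.X ^ m - 1) (Polynomial.monic_X_pow_sub_C 1 hm0) a₀
      (by rw [hmem]; simp [ha₀, hχ])
      (by
        refine IsUnit.map _ (isUnit_of_map_unit (algebraMap W k) _ (IsUnit.mk0 _ ?_))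
        simp [ha₀, hm, hχ0, Polynomial.derivative_X_pow])
    refine ⟨x, ?_, ?_⟩
    · simpa [sub_eq_zero] using hx
    · rwa [hmem, map_sub, sub_eq_zero, ha₀] at hxa
  choose l hl hl' using hex
  refine ⟨⟨⟨l, ?_⟩, ?_⟩, hl'⟩
  · exact eq_of_pow_eq_one_of_map_eq hm (hl 1) (one_pow m) (by simp [hl'])
  · intro g h
    exact eq_of_pow_eq_one_of_map_eq hm (hl _) (by rw [mul_pow, hl, hl, one_mul]) (by simp [hl'])

end Teichmuller

/-! ### Lifting matrix representations -/

section Lift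

variable {W k n : Type*} [CommRing W] [Field k] [Algebra W k] [Fintype n] [DecidableEq n]

theorem Matrix.exists_map_algebraMap_eq (hres : Function.Surjective (algebraMap W k))
    (A : Matrix n n k) : ∃ B : Matrix n n W, (algebraMap W k).mapMatrix B = A := by
  choose s hs using hres
  exact ⟨A.map s, by ext; simp [hs]⟩

theorem Matrix.exists_eq_smul_of_map_eq_zero {ϖ : W}
    (hϖ : ∀ x, algebraMap W k x = 0 ↔ ϖ ∣ x) {A : Matrix n n W}
    (hA : (algebraMap W k).mapMatrix A = 0) : ∃ B, A = ϖ • B := by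
  have (i j : n) : ϖ ∣ A i j := (hϖ _).1 (congrFun (congrFun hA i) j)
  choose B hB using this
  exact ⟨Matrix.of B, by ext i j; simp [hB i j]⟩

theorem Matrix.map_smul_eq_zero {ϖ : W} (hϖ : ∀ x, algebraMap W k x = 0 ↔ ϖ ∣ x)
    {m : ℕ} (hm : m ≠ 0) (B : Matrix n n W) : (algebraMap W k).mapMatrix (ϖ ^ m • B) = 0 := by
  ext i j
  simp [(hϖ ϖ).2 dvd_rfl, hm]

/-- The first-order expansion of the determinant at a matrix with unit determinant. -/
theorem Matrix.exists_det_add_pow_smul {A : Matrix n n W} (hA : IsUnit A.det) (ϖ : W) (m : ℕ)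
    (C : Matrix n n W) : ∃ t, (A + ϖ ^ m • C).det =
      A.det * (1 + ϖ ^ m * ((A⁻¹ * C).trace + ϖ ^ m * t)) := by
  have : A + ϖ ^ m • C = A * (1 + ϖ ^ m • (A⁻¹ * C)) := by
    rw [mul_add, mul_one, Matrix.mul_smul, Matrix.mul_nonsing_inv_cancel_left _ _ hA]
  rw [this, Matrix.det_mul, Matrix.det_one_add_smul]
  -- Dividing twice by `X` leaves the terms of order at least two.
  refine ⟨((1 + (Polynomial.X : Polynomial W) • (A⁻¹ * C).map Polynomial.C).det.divX.divX).eval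
    (ϖ ^ m), ?_⟩
  ring

theorem Matrix.map_trace_inv_mul {G : Type*} [Group G] {A : Matrix n n W} (hA : IsUnit A.det)
    (ρ : G →* Matrix n n k) {g : G} (hAg : (algebraMap W k).mapMatrix A = ρ g)
    (C : Matrix n n W) : algebraMap W k (A⁻¹ * C).trace =
      ((algebraMap W k).mapMatrix C * ρ g⁻¹).trace := by
  have h : (algebraMap W k).mapMatrix (A⁻¹ * C) = ρ g⁻¹ * (algebraMap W k).mapMatrix C := by
    conv_rhs => rw [← Matrix.mul_nonsing_inv_cancel_left A C hA, map_mul, hAg, ← mul_assoc,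
      ← map_mul]
    simp
  rw [Matrix.trace_mul_comm _ (ρ g⁻¹), ← h]
  exact AddMonoidHom.map_trace _ _

variable [IsLocalHom (algebraMap W k)]

theorem isUnit_one_add_pow_mul {ϖ : W} (hϖ : ∀ x, algebraMap W k x = 0 ↔ ϖ ∣ x) {m : ℕ}
    (hm : m ≠ 0) (t : W) : IsUnit (1 + ϖ ^ m * t) := by
  refine isUnit_of_map_unit (algebraMap W k) _ ?_
  simp [(hϖ ϖ).2 dvd_rfl, hm]

/-- A matrix whose determinant is congruent to a unit can be changed within its congruence class so
that the determinant is equal to that unit. -/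
theorem Matrix.exists_det_eq [Nonempty n] {ϖ : W} (hϖ : ∀ x, algebraMap W k x = 0 ↔ ϖ ∣ x) {m : ℕ}
    (hm : m ≠ 0) (A : Matrix n n W) {l t : W} (hA : A.det = l * (1 + ϖ ^ m * t)) :
    ∃ Y : Matrix n n W, (A + ϖ ^ m • Y).det = l := by
  obtain ⟨i⟩ := ‹Nonempty n›
  obtain ⟨u, hu⟩ := (isUnit_one_add_pow_mul hϖ hm t).exists_right_inv
  have hu' : u = 1 + ϖ ^ m * (-(t * u)) := by linear_combination hu
  -- This perturbation multiplies row `i` by `u`, the inverse of `1 + ϖ ^ m * t`.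
  refine ⟨Matrix.diagonal (Pi.single i (-(t * u))) * A, ?_⟩
  have hD : A + ϖ ^ m • (Matrix.diagonal (Pi.single i (-(t * u))) * A) =
      Matrix.diagonal (Function.update 1 i u) * A := by
    ext a b
    rcases eq_or_ne a i with rfl | h
    · simp only [Matrix.add_apply, Matrix.smul_apply, Matrix.diagonal_mul, Pi.single_eq_same,
        Function.update_self, smul_eq_mul]
      linear_combination (-A a b) * hu'
    · simp [h]
  rw [hD, Matrix.det_mul, Matrix.det_diagonal, Finset.prod_update_of_mem (Finset.mem_univ i), hA]
  simp only [Pi.one_apply, Finset.prod_const_one, mul_one]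
  linear_combination l * hu

variable [IsDomain W] {G : Type*} [Group G] [Fintype G]

/-- The error `C`, reduced and multiplied by `ρ (g * h)⁻¹`, is a 2-cocycle; multiplicativity of `l`
makes it trace zero to first order. Its averaged primitive, also trace zero by `hθ0`, corrects `f`
without changing the determinant modulo `ϖ ^ (m + 1)`, and a further correction of that order
restores the determinant exactly. -/
theorem exists_lift_step [Nonempty n] (hres : Function.Surjective (algebraMap W k)) {ϖ : W}
    (hϖ0 : ϖ ≠ 0) (hϖ : ∀ x, algebraMap W k x = 0 ↔ ϖ ∣ x) (ρ : G →* Matrix n n k) (l : G →* W)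
    (θ : Matrix n n k →ₗ[k] Matrix n n k) (hθ0 : ∀ x, x.trace = 0 → (θ x).trace = 0)
    (hθ : ∀ x, x.trace = 0 → conjSum (conjBy k ρ) θ x = x) {m : ℕ} (hm : m ≠ 0)
    (f : G → Matrix n n W) (hf : ∀ g, (algebraMap W k).mapMatrix (f g) = ρ g)
    (hfl : ∀ g, (f g).det = l g) (hmul : ∀ g h, ∃ C, f g * f h = f (g * h) + ϖ ^ m • C) :
    ∃ f' : G → Matrix n n W, (∀ g, ∃ B, f' g = f g + ϖ ^ m • B) ∧ (∀ g, (f' g).det = l g) ∧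
      ∀ g h, ∃ C, f' g * f' h = f' (g * h) + ϖ ^ (m + 1) • C := by
  choose C hC using hmul
  let φ := (algebraMap W k).mapMatrix (m := n)
  have hϖk : algebraMap W k ϖ = 0 := (hϖ ϖ).2 dvd_rfl
  have hlu (g) : IsUnit (f g).det := by
    rw [hfl]
    exact (Group.isUnit g).map l
  have hρ (g : G) : ρ g⁻¹ * ρ g = 1 := by simp [← map_mul]
  have hρ' (g : G) : ρ g * ρ g⁻¹ = 1 := by simp [← map_mul]
  have hϖm : ϖ ^ m ≠ 0 := pow_ne_zero _ hϖ0
  let c (g h : G) : Matrix n n k := φ (C g h) * ρ (g * h)⁻¹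
  -- Compare determinants in `hC`: the first-order term must vanish modulo `ϖ`.
  have htr (g h : G) : (c g h).trace = 0 := by
    obtain ⟨t, ht⟩ := Matrix.exists_det_add_pow_smul (hlu (g * h)) ϖ m (C g h)
    rw [← hC, Matrix.det_mul, hfl, hfl, hfl, ← map_mul] at ht
    have h1 : l (g * h) * (ϖ ^ m * (((f (g * h))⁻¹ * C g h).trace + ϖ ^ m * t)) = 0 := by
      linear_combination -ht
    have h2 := (mul_eq_zero.1 ((((Group.isUnit (g * h)).map l).mul_right_eq_zero).1 h1)).resolve_left
      hϖm
    have h3 := congrArg (algebraMap W k) h2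
    rw [map_add, map_mul, map_pow, hϖk, zero_pow hm, zero_mul, add_zero, map_zero,
      Matrix.map_trace_inv_mul (hlu _) ρ (hf _)] at h3
    exact h3
  have hcoc (g h j : G) : conjBy k ρ g (c h j) + c g (h * j) = c (g * h) j + c g h := by
    have h1 : f g * C h j + C g (h * j) = C (g * h) j + C g h * f j := by
      have h2 : ϖ ^ m • (f g * C h j + C g (h * j)) = ϖ ^ m • (C (g * h) j + C g h * f j) := by
        have e1 := mul_assoc (f g) (f h) (f j)
        rw [hC g h, hC h j, add_mul, mul_add, hC, hC g (h * j), mul_assoc g h j] at e1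
        simp only [Matrix.smul_mul, Matrix.mul_smul, smul_add] at e1 ⊢
        rw [add_assoc, add_assoc, add_right_inj] at e1
        rw [add_comm, ← e1]
      exact smul_right_injective _ hϖm h2
    have h2 := congrArg (fun X ↦ φ X * ρ (g * h * j)⁻¹) h1
    simp only [φ, map_add, map_mul, hf, add_mul] at h2
    have e1 : conjBy k ρ g (c h j) = ρ g * φ (C h j) * ρ (g * h * j)⁻¹ := by
      rw [conjBy_apply]
      simp [c, mul_assoc, ← map_mul]
    have e2 : c g h = φ (C g h) * ρ j * ρ (g * h * j)⁻¹ := by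
      simp [c, mul_assoc, ← map_mul]
    rw [e1, e2]
    simpa only [c, mul_assoc g h j] using h2
  let b (g : G) : Matrix n n k :=
    ∑ j, conjBy k ρ (g * j) (θ (conjBy k ρ (g * j)⁻¹ (c g j)))
  have htrconj (g : G) (x : Matrix n n k) : (conjBy k ρ g x).trace = x.trace := by
    rw [conjBy_apply, Matrix.trace_mul_comm, ← mul_assoc, hρ, one_mul]
  have hbtr (g : G) : (b g).trace = 0 := by
    simp only [b, Matrix.trace_sum, htrconj]
    exact Finset.sum_eq_zero fun j _ ↦ hθ0 _ (by rw [htrconj, htr])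
  have hb := twoCocycle_eq_coboundary (conjBy k ρ) θ c hcoc (fun g h ↦ hθ _ (htr g h)) b
    fun _ ↦ rfl
  choose B hB using fun g ↦ Matrix.exists_map_algebraMap_eq hres (-(b g * ρ g))
  have hdet (g : G) : ∃ Y : Matrix n n W,
      ((f g + ϖ ^ m • B g) + ϖ ^ (m + 1) • Y).det = l g := by
    obtain ⟨t, ht⟩ := Matrix.exists_det_add_pow_smul (hlu g) ϖ m (B g)
    have h0 : algebraMap W k ((f g)⁻¹ * B g).trace = 0 := by
      rw [Matrix.map_trace_inv_mul (hlu _) ρ (hf _), hB, neg_mul, mul_assoc, hρ', mul_one,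
        Matrix.trace_neg, hbtr, neg_zero]
    obtain ⟨s, hs⟩ := (hϖ _).1 h0
    -- As `m ≥ 1`, the quadratic term `ϖ ^ (2 * m)` is divisible by `ϖ ^ (m + 1)`.
    obtain ⟨i, rfl⟩ : ∃ i, m = i + 1 := ⟨m - 1, by omega⟩
    refine Matrix.exists_det_eq hϖ (Nat.succ_ne_zero _) _ (t := s + ϖ ^ i * t) ?_
    rw [ht, hs, hfl, Nat.succ_eq_add_one]
    ring
  choose Y hY using hdet
  let B' (g : G) := B g + ϖ • Y g
  have hf' (g : G) : (f g + ϖ ^ m • B g) + ϖ ^ (m + 1) • Y g = f g + ϖ ^ m • B' g := by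
    simp only [B', smul_add, smul_smul, ← pow_succ, add_assoc]
  have hφB' (g : G) : φ (B' g) = -(b g * ρ g) := by
    have := Matrix.map_smul_eq_zero hϖ one_ne_zero (Y g)
    rw [pow_one] at this
    simp only [φ, B', map_add, hB, this, add_zero]
  simp only [hf'] at hY
  refine ⟨fun g ↦ f g + ϖ ^ m • B' g, fun g ↦ ⟨_, rfl⟩, hY, fun g h ↦ ?_⟩
  -- The argument of `φ` is the coefficient of `ϖ ^ m` in the new multiplicativity error; its
  -- reduction vanishes by the coboundary equation `hb`.
  have hzero : φ (C g h + f g * B' h + B' g * f h + ϖ ^ m • (B' g * B' h) - B' (g * h)) = 0 := by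
    have e := congrArg (fun X ↦ X * ρ (g * h)) (hb g h)
    simp only [add_mul, conjBy_apply, c, mul_assoc, hρ, mul_one] at e
    simp only [φ, map_add, map_sub, map_mul, Matrix.map_smul_eq_zero hϖ hm, hf] at hφB' ⊢
    have e' : ρ g⁻¹ * ρ (g * h) = ρ h := by simp [← map_mul]
    rw [e', map_mul ρ g h] at e
    simp only [hφB']
    rw [map_mul ρ g h]
    simp only [mul_neg, neg_mul, mul_assoc]
    refine neg_eq_zero.1 (Eq.trans ?_ (sub_eq_zero.2 e))
    simp only [φ]
    abel
  obtain ⟨Z, hZ⟩ := Matrix.exists_eq_smul_of_map_eq_zero hϖ hzero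
  refine ⟨Z, ?_⟩
  rw [pow_succ, ← smul_smul, ← hZ]
  simp only [add_mul, mul_add, Matrix.smul_mul, Matrix.mul_smul, smul_add, smul_sub, hC]
  abel

omit [IsLocalHom (algebraMap W k)] [Field k] [Algebra W k] [IsDomain W] [Fintype n] [DecidableEq n] in
theorem Matrix.exists_limit {ϖ : W} [IsAdicComplete (Ideal.span {ϖ}) W] (f : ℕ → Matrix n n W)
    (hf : ∀ m, ∃ B, f (m + 1) = f m + ϖ ^ m • B) :
    ∃ F : Matrix n n W, ∀ m, ∃ B, F = f m + ϖ ^ m • B := by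
  have hmod (m : ℕ) (x y : W) :
      x ≡ y [SMOD (Ideal.span {ϖ} ^ m • ⊤ : Submodule W W)] ↔ ∃ b, y = x + ϖ ^ m * b := by
    rw [SModEq.comm, SModEq.sub_mem, smul_eq_mul, Ideal.mul_top, Ideal.span_singleton_pow,
      Ideal.mem_span_singleton]
    exact exists_congr fun b ↦ by rw [sub_eq_iff_eq_add']
  have hcauchy {m m' : ℕ} (h : m ≤ m') : ∃ B, f m' = f m + ϖ ^ m • B := by
    induction m', h using Nat.le_induction with
    | base => exact ⟨0, by simp⟩
    | succ m' h ih =>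
      obtain ⟨B, hB⟩ := ih
      obtain ⟨B', hB'⟩ := hf m'
      refine ⟨B + ϖ ^ (m' - m) • B', ?_⟩
      rw [hB', hB, smul_add, smul_smul, ← pow_add, Nat.add_sub_cancel' h, add_assoc]
  have (i j : n) : ∃ L : W, ∀ m, ∃ b, L = f m i j + ϖ ^ m * b := by
    obtain ⟨L, hL⟩ := IsPrecomplete.prec (I := Ideal.span {ϖ}) (M := W) inferInstance
      (f := fun m ↦ f m i j) (fun {m m'} h ↦ by
        obtain ⟨B, hB⟩ := hcauchy h
        rw [hmod]
        exact ⟨B i j, by simp [hB]⟩)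
    exact ⟨L, fun m ↦ (hmod _ _ _).1 (hL m)⟩
  choose F B hB using this
  exact ⟨Matrix.of F, fun m ↦ ⟨Matrix.of fun i j ↦ B i j m, by ext i j; simpa using hB i j m⟩⟩

omit [IsLocalHom (algebraMap W k)] [Field k] [Algebra W k] [IsDomain W] [DecidableEq n]
  [Fintype n] in
theorem Matrix.eq_of_forall_eq_add_pow_smul {ϖ : W} [IsAdicComplete (Ideal.span {ϖ}) W]
    {A B : Matrix n n W} (h : ∀ m, ∃ C, A = B + ϖ ^ m • C) : A = B := by
  ext i j
  refine sub_eq_zero.1 (IsHausdorff.haus (I := Ideal.span {ϖ}) (M := W) inferInstance _ fun m ↦ ?_)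
  obtain ⟨C, hC⟩ := h m
  rw [SModEq.zero, smul_eq_mul, Ideal.mul_top, Ideal.span_singleton_pow,
      Ideal.mem_span_singleton]
  exact ⟨C i j, by simp [hC]⟩

/-- A matrix representation over the residue field lifts if the identity on trace zero matrices is
a sum of conjugates and the determinant lifts. -/
theorem exists_monoidHom_matrix_lift [Nonempty n] (hres : Function.Surjective (algebraMap W k))
    {ϖ : W} (hϖ0 : ϖ ≠ 0) (hϖ : ∀ x, algebraMap W k x = 0 ↔ ϖ ∣ x)
    [IsAdicComplete (Ideal.span {ϖ}) W] (ρ : G →* Matrix n n k) (l : G →* W)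
    (hl : ∀ g, algebraMap W k (l g) = (ρ g).det)
    (θ : Matrix n n k →ₗ[k] Matrix n n k) (hθ0 : ∀ x, x.trace = 0 → (θ x).trace = 0)
    (hθ : ∀ x, x.trace = 0 → conjSum (conjBy k ρ) θ x = x) :
    ∃ F : G →* Matrix n n W, ∀ g, (algebraMap W k).mapMatrix (F g) = ρ g := by
  -- Stage `m` is multiplicative modulo `ϖ ^ (m + 1)`, since `exists_lift_step` needs a nonzero
  -- exponent.
  let Good (m : ℕ) (f : G → Matrix n n W) : Prop :=
    (∀ g, (algebraMap W k).mapMatrix (f g) = ρ g) ∧ (∀ g, (f g).det = l g) ∧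
      ∀ g h, ∃ C, f g * f h = f (g * h) + ϖ ^ (m + 1) • C
  have hstart : ∃ f, Good 0 f := by
    have (g : G) : ∃ A : Matrix n n W, (algebraMap W k).mapMatrix A = ρ g ∧ A.det = l g := by
      obtain ⟨A, hA⟩ := Matrix.exists_map_algebraMap_eq hres (ρ g)
      have h0 : algebraMap W k (A.det - l g) = 0 := by
        rw [map_sub, hl, RingHom.map_det, hA, sub_self]
      obtain ⟨t, ht⟩ := (hϖ _).1 h0
      have hlinv : l g * l g⁻¹ = 1 := by simp [← map_mul]
      obtain ⟨Y, hY⟩ := Matrix.exists_det_eq hϖ one_ne_zero A (l := l g) (t := l g⁻¹ * t) (by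
        linear_combination ht - ϖ * t * hlinv)
      exact ⟨_, by rw [map_add, Matrix.map_smul_eq_zero hϖ one_ne_zero, hA, add_zero], hY⟩
    choose f hf hfl using this
    refine ⟨f, hf, hfl, fun g h ↦ ?_⟩
    obtain ⟨C, hC⟩ := Matrix.exists_eq_smul_of_map_eq_zero (A := f g * f h - f (g * h)) hϖ (by
      simp [-RingHom.mapMatrix_apply, hf])
    exact ⟨C, by rw [zero_add, pow_one, ← hC, add_sub_cancel]⟩
  have hstep (m : ℕ) (f) (hf : Good m f) :
      ∃ f', Good (m + 1) f' ∧ ∀ g, ∃ B, f' g = f g + ϖ ^ (m + 1) • B := by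
    obtain ⟨f', h1, h2, h3⟩ := exists_lift_step hres hϖ0 hϖ ρ l θ hθ0 hθ (Nat.succ_ne_zero m) f
      hf.1 hf.2.1 hf.2.2
    refine ⟨f', ⟨fun g ↦ ?_, h2, h3⟩, h1⟩
    obtain ⟨B, hB⟩ := h1 g
    rw [hB, map_add, Matrix.map_smul_eq_zero hϖ (Nat.succ_ne_zero m), hf.1, add_zero]
  obtain ⟨f₀, hf₀⟩ := hstart
  choose! next hnext hnext' using hstep
  let f (m : ℕ) : G → Matrix n n W := Nat.rec f₀ next m
  have hgood (m : ℕ) : Good m (f m) := by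
    induction m with
    | zero => exact hf₀
    | succ m ih => exact hnext m _ ih
  have hsucc (g : G) (m : ℕ) : ∃ B, f (m + 1) g = f m g + ϖ ^ m • B := by
    obtain ⟨B, hB⟩ := hnext' m (f m) (hgood m) g
    exact ⟨ϖ • B, by rw [smul_smul, ← pow_succ]; exact hB⟩
  choose F hF using fun g ↦ Matrix.exists_limit (fun m ↦ f m g) (hsucc g)
  have hmul (g h : G) : F g * F h = F (g * h) := by
    refine Matrix.eq_of_forall_eq_add_pow_smul (ϖ := ϖ) fun m ↦ ?_
    obtain ⟨B, hB⟩ := hF g m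
    obtain ⟨B', hB'⟩ := hF h m
    obtain ⟨B'', hB''⟩ := hF (g * h) m
    obtain ⟨C, hC⟩ := (hgood m).2.2 g h
    refine ⟨B * F h + f m g * B' + ϖ • C - B'', ?_⟩
    have e1 : f m g * F h = f (m : ℕ) (g * h) + ϖ ^ m • (ϖ • C + f m g * B') := by
      rw [hB', mul_add, hC, Matrix.mul_smul, smul_add, smul_smul, ← pow_succ, add_assoc]
    have e2 : F g * F h = f m g * F h + ϖ ^ m • (B * F h) := by
      rw [hB, add_mul, Matrix.smul_mul]
    rw [e2, e1, hB'']
    simp only [smul_add, smul_sub]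
    abel
  have hmap (g : G) : (algebraMap W k).mapMatrix (F g) = ρ g := by
    obtain ⟨B, hB⟩ := hF g 1
    rw [hB, map_add, (hgood 1).1, Matrix.map_smul_eq_zero hϖ one_ne_zero, add_zero]
  -- The stages need not preserve the identity, but `F 1` is an invertible idempotent.
  have hone : F 1 = 1 := by
    have hu : IsUnit (F 1) := by
      rw [Matrix.isUnit_iff_isUnit_det]
      refine isUnit_of_map_unit (algebraMap W k) _ ?_
      rw [RingHom.map_det, hmap]
      simp
    have := hmul 1 1
    rw [mul_one] at this
    exact hu.mul_eq_left.1 this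
  exact ⟨⟨⟨F, hone⟩, fun g h ↦ (hmul g h).symm⟩, hmap⟩

end Lift

/-! ### Lifting the splitting from `k` to `W` -/

theorem conjSum_smul_id {R G A : Type*} [CommRing R] [Group G] [Fintype G]
    [AddCommGroup A] [Module R A] (τ : Representation R G A) {c : R}
    (hc : (Fintype.card G : R) * c = 1) (x : A) : conjSum τ (c • LinearMap.id) x = x := by
  have (g : G) : τ g (τ g⁻¹ x) = x := by simp [← Module.End.mul_apply, ← map_mul]
  simp only [conjSum_apply, LinearMap.smul_apply, LinearMap.id_apply, map_smul, this,
    Finset.sum_const, Finset.card_univ]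
  rw [← Nat.cast_smul_eq_nsmul R, smul_smul, hc, one_smul]

theorem conjSum_conjBy_algEquiv {R G A B : Type*} [CommRing R] [Group G] [Fintype G] [Ring A]
    [Ring B] [Algebra R A] [Algebra R B] (f : G →* A) (e : A ≃ₐ[R] B) (θ : A →ₗ[R] A) (x : A) :
    conjSum (conjBy R ((e : A →* B).comp f))
      (e.toLinearMap ∘ₗ θ ∘ₗ e.symm.toLinearMap) (e x) = e (conjSum (conjBy R f) θ x) := by
  simp [conjSum_apply, conjBy_apply]

/-- Sums of conjugates fixing the kernel of a retraction lift along a reduction map. -/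
theorem exists_conjSum_lift {W k G A B : Type*} [CommRing W] [CommRing k] [Algebra W k] [Group G]
    [Fintype G] [AddCommGroup A] [Module W A] [Module.Finite W A] [Module.Projective W A]
    [AddCommGroup B] [Module k B] [Module W B] [IsScalarTower W k B]
    (τ : Representation W G A) (τ' : Representation k G B) (red : A →ₗ[W] B)
    (hred : Function.Surjective red) {ϖ : W} (hϖ : Ideal.span {ϖ} ≤ Ideal.jacobson ⊥)
    (hker : ∀ x, red x = 0 → ∃ y, x = ϖ • y) (hτ : ∀ g x, red (τ g x) = τ' g (red x))
    {e : A} (he : ∀ g, τ g e = e) {r : A →ₗ[W] W} (hr : ∀ g x, r (τ g x) = r x) (hre : r e = 1)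
    (θ' : B →ₗ[k] B) (hθ' : ∀ x, r x = 0 → conjSum τ' θ' (red x) = red x) :
    ∃ θ : A →ₗ[W] A, ∀ x, r x = 0 → conjSum τ θ x = x := by
  obtain ⟨θ, hθ⟩ := Module.projective_lifting_property red (θ'.restrictScalars W ∘ₗ red) hred
  have hθ (x : A) : red (θ x) = θ' (red x) := LinearMap.congr_fun hθ x
  have hsum (x : A) : red (conjSum τ θ x) = conjSum τ' θ' (red x) := by
    simp [conjSum_apply, hτ, hθ]
  let q : A →ₗ[W] A := LinearMap.id - r.smulRight e
  have hq (x) : q x = x - r x • e := by simp [q]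
  have hqr (x) : r (q x) = 0 := by simp [hq, hre]
  have hqc (g x) : q (τ g x) = τ g (q x) := by simp [hq, hr, he]
  -- `N` is equivariant and congruent to the identity modulo `ϖ`, hence bijective by Nakayama; its
  -- inverse corrects the naive lift `θ`.
  let N : A →ₗ[W] A := conjSum τ θ ∘ₗ q + r.smulRight e
  have hN (x) : N x = conjSum τ θ (q x) + r x • e := by simp [N]
  have hNc (g x) : N (τ g x) = τ g (N x) := by simp [hN, hr, he, hqc, conjSum_comm]
  have hNred (x) : ∃ y, x = N x + ϖ • y := by
    obtain ⟨y, hy⟩ := hker (x - N x) (by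
      rw [map_sub, hN, map_add, hsum, hθ' _ (hqr x), ← map_add, hq, sub_add_cancel, sub_self])
    exact ⟨y, by rw [← hy, add_sub_cancel]⟩
  have hsurj : Function.Surjective N := by
    rw [← LinearMap.range_eq_top, eq_top_iff]
    refine Submodule.le_of_le_smul_of_le_jacobson_bot Module.Finite.fg_top hϖ fun x _ ↦ ?_
    obtain ⟨y, hy⟩ := hNred x
    rw [hy]
    exact Submodule.add_mem_sup (LinearMap.mem_range_self N x)
      (Submodule.smul_mem_smul (Ideal.mem_span_singleton_self ϖ) trivial)
  let E : A ≃ₗ[W] A := LinearEquiv.ofBijective N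
    ⟨OrzechProperty.injective_of_surjective_endomorphism N hsurj, hsurj⟩
  have hE (x) : N (E.symm x) = x := E.apply_symm_apply x
  have hEc (g x) : E.symm (τ g x) = τ g (E.symm x) := by
    refine E.injective ?_
    rw [E.apply_symm_apply]
    exact (congrArg (τ g) (hE x)).symm.trans (hNc _ _).symm
  -- For `r x = 0`, the equation `N (E.symm x) = x` gives `x` up to a multiple of `e`, which the
  -- outer `q` removes.
  refine ⟨q ∘ₗ θ ∘ₗ q ∘ₗ E.symm.toLinearMap, fun x hx ↦ ?_⟩
  rw [conjSum_comp_left _ _ _ hqc, conjSum_comp_right _ _ _ (by simp [hqc, hEc])]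
  have h := hE x
  rw [hN, ← eq_sub_iff_add_eq] at h
  simp only [LinearMap.comp_apply, LinearEquiv.coe_coe, h, map_sub, map_smul]
  simp [hq, hx, hre]

/-- Maschke averaging. The functional `r` is arbitrary because the rank may fail to be invertible,
so the trace cannot always be normalised. -/
theorem isEndoTrivial_of_card_mul_eq_one {R : Type u} {G : Type w} {M : Type x} [CommRing R]
    [Group G] [Fintype G] [AddCommGroup M] [Module R M] [Module.Finite R M] [Module.Free R M]
    (σ : Representation R G M) {c : R} (hc : (Fintype.card G : R) * c = 1)
    {r : Module.End R M →ₗ[R] R} (hr : r 1 = 1) : IsEndoTrivial σ := by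
  refine isEndoTrivial_of_retraction σ (c • ∑ g, r ∘ₗ conjBy R σ g) (fun g x ↦ ?_) ?_
    (c • LinearMap.id) (fun x _ ↦ conjSum_smul_id _ hc x)
  · simp only [LinearMap.smul_apply, LinearMap.sum_apply, LinearMap.comp_apply]
    congr 1
    exact Fintype.sum_equiv (Equiv.mulRight g) _ _ fun h ↦ by simp
  · simp [conjBy_one, hr, mul_comm c, hc]

theorem conjBy_trace {R G M : Type*} [CommRing R] [Group G] [AddCommGroup M] [Module R M]
    (σ : Representation R G M) (g : G) (x : Module.End R M) :
    LinearMap.trace R M (conjBy R σ g x) = LinearMap.trace R M x := by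
  rw [conjBy_apply, LinearMap.trace_mul_comm, ← mul_assoc, ← map_mul]
  simp

/-! ### Dimension and trace of an endo-trivial module -/

section Field

variable {k : Type u} {G : Type w} {V : Type x} [Field k] [Group G] [Fintype G]
  [AddCommGroup V] [Module k V]

theorem IsEndoTrivial.nontrivial {ρ : Representation k G V} (h : IsEndoTrivial ρ) :
    Nontrivial V := by
  obtain ⟨z, π, -, -, -, hz, -⟩ := h.exists_splitting
  by_contra hV
  rw [not_nontrivial_iff_subsingleton] at hV
  simp [Subsingleton.elim z 0] at hz

/-- In the trace of the identity of `End V`, the projective part contributes a multiple of `|G|`,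
that is zero, and the trivial part contributes `1`; so the square of the dimension is `1` in `k`. -/
theorem IsEndoTrivial.finrank_ne_zero {ρ : Representation k G V} (h : IsEndoTrivial ρ)
    (hG : (Fintype.card G : k) = 0) : (Module.finrank k V : k) ≠ 0 := by
  obtain ⟨z, π, θ, -, -, hz, hθ⟩ := h.exists_splitting
  obtain ⟨_, _, -⟩ := h
  have hid : LinearMap.id = π.smulRight z + conjSum (conjBy k ρ) θ := by
    ext1 x
    simpa using hθ x
  have h1 := congrArg (LinearMap.trace k (Module.End k V)) hid
  rw [map_add, trace_conjSum, hG, zero_mul, add_zero, LinearMap.trace_id, LinearMap.trace_smulRight,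
    hz, Module.finrank_linearMap, Nat.cast_mul] at h1
  intro h0
  simp [h0] at h1

/-- If the order of `G` vanishes in `k`, the identity on the trace zero endomorphisms of an
endo-trivial module is a sum of conjugates. -/
theorem IsEndoTrivial.exists_conjSum_trace {ρ : Representation k G V} (h : IsEndoTrivial ρ)
    (hG : (Fintype.card G : k) = 0) :
    ∃ θ : Module.End k V →ₗ[k] Module.End k V, (∀ x, LinearMap.trace k V (θ x) = 0) ∧
      ∀ x, LinearMap.trace k V x = 0 → conjSum (conjBy k ρ) θ x = x := by
  have hd := h.finrank_ne_zero hG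
  obtain ⟨z, π, θ, hz, hπ, hπz, hθ⟩ := h.exists_splitting
  obtain ⟨_, _, -⟩ := h
  let r : Module.End k V →ₗ[k] k := (Module.finrank k V : k)⁻¹ • LinearMap.trace k V
  have hr (g x) : r (conjBy k ρ g x) = r x := by simp [r, conjBy_trace]
  have hr1 : r 1 = 1 := by simp [r, hd]
  obtain ⟨θ', hθ'⟩ := exists_conjSum_eq_sub (conjBy k ρ) hG hz hπ hπz hθ (conjBy_one ρ) hr hr1
  let q : Module.End k V →ₗ[k] Module.End k V := LinearMap.id - r.smulRight 1
  have hq (x) : q x = x - r x • 1 := by simp [q]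
  refine ⟨q ∘ₗ θ', fun x ↦ ?_, fun x hx ↦ ?_⟩
  · simp only [LinearMap.comp_apply, hq, map_sub, map_smul, LinearMap.trace_one]
    simp [r]
    field_simp
    simp
  · have hrx : r x = 0 := by simp [r, hx]
    rw [conjSum_comp_left _ _ _ (fun g x ↦ by simp [hq, hr, conjBy_one])]
    simp [hθ', hq, hrx]

end Field

/-- An equivariant linear equivalence gives an isomorphism of modules over the group algebra. -/
theorem Representation.nonempty_asModule_equiv {R G V V' : Type*} [CommRing R] [Group G]
    [AddCommGroup V] [Module R V] [AddCommGroup V'] [Module R V'] (ρ : Representation R G V)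
    (ρ' : Representation R G V') (E : V ≃ₗ[R] V') (hE : ∀ g x, E (ρ g x) = ρ' g (E x)) :
    Nonempty (ρ.asModule ≃ₗ[R[G]] ρ'.asModule) := by
  let E' : ρ.asModule ≃ₗ[R] ρ'.asModule := ρ.asModuleEquiv.trans (E.trans ρ'.asModuleEquiv.symm)
  refine ⟨LinearEquiv.ofBijective (MonoidAlgebra.equivariantOfLinearOfComm E'.toLinearMap ?_) ?_⟩
  · intro g x
    refine ρ'.asModuleEquiv.injective ?_
    rw [asModuleEquiv_single_smul]
    change E (ρ.asModuleEquiv _) = ρ' g (E _)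
    rw [asModuleEquiv_single_smul, hE]
    rfl
  · exact E'.bijective

/-! ### From matrices back to representations -/

section Matrix

variable {W k G V n : Type*} [CommRing W] [Field k] [Algebra W k] [Group G]
  [AddCommGroup V] [Module k V] [Fintype n] [DecidableEq n]

/-- The representation on column vectors given by a matrix representation. -/
noncomputable def matrixRep (F : G →* Matrix n n W) : Representation W G (n → W) :=
  (Matrix.toLinAlgEquiv' : Matrix n n W ≃ₐ[W] Module.End W (n → W)).toMonoidHom.comp F

theorem matrixRep_apply (F : G →* Matrix n n W) (g : G) :
    matrixRep F g = Matrix.toLinAlgEquiv' (F g) := rfl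

theorem isLiftOf_matrixRep (ρ : Representation k G V) (b : Module.Basis n k V)
    (F : G →* Matrix n n W)
    (hF : ∀ g, (algebraMap W k).mapMatrix (F g) = LinearMap.toMatrixAlgEquiv b (ρ g)) :
    IsLiftOf (matrixRep F) ρ := by
  let B := (Pi.basisFun W n).baseChange k
  let E := B.equiv b (Equiv.refl n)
  have hB (i : n) : B i = 1 ⊗ₜ[W] Pi.basisFun W n i := Module.Basis.baseChange_apply ..
  have hE (i : n) : E (B i) = b i := B.equiv_apply ..
  have hcol (g : G) (j : n) : matrixRep F g (Pi.basisFun W n j) =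
      ∑ i, F g i j • Pi.basisFun W n i := by
    ext i
    simp [matrixRep_apply, Pi.single_apply]
  have hsum (g : G) : E.toLinearMap ∘ₗ baseChangeRep k (matrixRep F) g = ρ g ∘ₗ E.toLinearMap := by
    refine B.ext fun j ↦ ?_
    have h1 : baseChangeRep k (matrixRep F) g (B j) = ∑ i, algebraMap W k (F g i j) • B i := by
      simp only [hB]
      change (matrixRep F g).baseChange k _ = _
      rw [LinearMap.baseChange_tmul, hcol, TensorProduct.tmul_sum]
      simp only [TensorProduct.tmul_smul, algebraMap_smul]
    have h2 (i : n) : algebraMap W k (F g i j) = b.repr (ρ g (b j)) i := by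
      rw [← LinearMap.toMatrixAlgEquiv_apply, ← hF]
      rfl
    simp only [LinearMap.comp_apply, LinearEquiv.coe_coe, h1, map_sum, map_smul, hE, h2]
    exact b.sum_repr _
  exact ⟨inferInstance, inferInstance, Representation.nonempty_asModule_equiv _ _ E
    fun g x ↦ LinearMap.congr_fun (hsum g) x⟩

end Matrix

/-! ### The main theorem -/

theorem lemma3p1 {p : ℕ} (hp : p.Prime) {k : Type u} [Field k] [CharP k p]
    {W : Type v} [CommRing W] [IsDomain W] [IsDiscreteValuationRing W] [CharZero W]
    [IsAdicComplete (IsLocalRing.maximalIdeal W) W]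
    [Algebra W k] (hres : Function.Surjective (algebraMap W k))
    {G : Type w} [Group G] [Finite G]
    {V : Type x} [AddCommGroup V] [Module k V] (ρ : Representation k G V)
    (hρ : IsEndoTrivial ρ) :
    ∃ (M : Type v) (_ : AddCommGroup M) (_ : Module W M) (σ : Representation W G M),
      IsLiftOf σ ρ ∧ IsEndoTrivial σ := by
  have := Fintype.ofFinite G
  have hloc : IsLocalHom (algebraMap W k) := IsLocalHom.of_surjective _ hres
  obtain ⟨ϖ, hirr⟩ := IsDiscreteValuationRing.exists_irreducible W
  have hmax := hirr.maximalIdeal_eq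
  have hϖ (x : W) : algebraMap W k x = 0 ↔ ϖ ∣ x := by
    rw [← Ideal.mem_span_singleton, ← hmax, IsLocalRing.mem_maximalIdeal, mem_nonunits_iff,
      ← isUnit_map_iff (algebraMap W k), isUnit_iff_ne_zero, not_not]
  have hunit (a : W) (ha : algebraMap W k a ≠ 0) : ∃ c, a * c = 1 :=
    (isUnit_of_map_unit (algebraMap W k) a (IsUnit.mk0 _ ha)).exists_right_inv
  have : IsAdicComplete (Ideal.span {ϖ}) W := hmax ▸ inferInstance
  have hnt := hρ.nontrivial
  have hfin := hρ.1
  let b := Module.finBasis k V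
  have : Nonempty (Fin (Module.finrank k V)) := b.index_nonempty
  let e := LinearMap.toMatrixAlgEquiv b
  let ρm : G →* Matrix (Fin (Module.finrank k V)) (Fin (Module.finrank k V)) k :=
    (e : Module.End k V →* _).comp ρ
  have htr (x : Module.End k V) : (e x).trace = LinearMap.trace k V x :=
    (LinearMap.trace_eq_matrix_trace k b x).symm
  obtain ⟨l, hl⟩ := exists_monoidHom_lift hp hres (Matrix.detMonoidHom.comp ρm)
  by_cases hG : (Fintype.card G : k) = 0
  · have hd := hρ.finrank_ne_zero hG
    obtain ⟨θ, hθ0, hθ⟩ := hρ.exists_conjSum_trace hG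
    have hθe (x) (hx : Matrix.trace x = 0) : conjSum (conjBy k ρm)
        (e.toLinearMap ∘ₗ θ ∘ₗ e.symm.toLinearMap) x = x := by
      obtain ⟨x, rfl⟩ := e.surjective x
      rw [conjSum_conjBy_algEquiv, hθ _ (by rwa [← htr])]
    obtain ⟨F, hF⟩ := exists_monoidHom_matrix_lift hres hirr.ne_zero hϖ ρm l hl
      (e.toLinearMap ∘ₗ θ ∘ₗ e.symm.toLinearMap) (fun x _ ↦ by simp [htr, hθ0]) hθe
    let σ := matrixRep F
    refine ⟨_, _, _, σ, isLiftOf_matrixRep ρ b F hF, ?_⟩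
    -- The rank is a unit of `W` because it is nonzero in `k`, so the normalised trace is a
    -- retraction onto the scalars.
    obtain ⟨c, hc⟩ := hunit (Module.finrank k V) (by simpa using hd)
    let r : Module.End W (Fin (Module.finrank k V) → W) →ₗ[W] W := c • LinearMap.trace W _
    have hr (g x) : r (conjBy W σ g x) = r x := by simp [r, conjBy_trace]
    have hr1 : r 1 = 1 := by simp [r, mul_comm c, hc]
    let red : Module.End W (Fin (Module.finrank k V) → W) →ₗ[W]
        Matrix (Fin (Module.finrank k V)) (Fin (Module.finrank k V)) k :=
      (Algebra.linearMap W k).mapMatrix ∘ₗ LinearMap.toMatrixAlgEquiv'.toLinearMap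
    have hred (x) : red x = (algebraMap W k).mapMatrix (LinearMap.toMatrixAlgEquiv' x) := rfl
    obtain ⟨θW, hθW⟩ := exists_conjSum_lift (conjBy W σ) (conjBy k ρm) red (fun y ↦ by
        obtain ⟨B, hB⟩ := Matrix.exists_map_algebraMap_eq hres y
        exact ⟨Matrix.toLinAlgEquiv' B, by rw [hred, ← hB]; simp⟩)
      (ϖ := ϖ) (by rw [← hmax]; exact IsLocalRing.maximalIdeal_le_jacobson _)
      (fun x hx ↦ by
        obtain ⟨B, hB⟩ := Matrix.exists_eq_smul_of_map_eq_zero hϖ hx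
        exact ⟨Matrix.toLinAlgEquiv' B, LinearMap.toMatrixAlgEquiv'.injective (by
          rw [map_smul, LinearMap.toMatrixAlgEquiv'_toLinAlgEquiv']
          exact hB)⟩)
      (fun g x ↦ by
        simp only [hred, conjBy_apply, map_mul, ← hF]
        simp [σ, matrixRep_apply])
      (conjBy_one _) hr hr1 (e.toLinearMap ∘ₗ θ ∘ₗ e.symm.toLinearMap) (fun x hx ↦ hθe _ (by
        have hx0 : LinearMap.trace W _ x = 0 := by
          rw [← one_mul (LinearMap.trace W _ x), ← hc, mul_assoc]
          exact mul_eq_zero_of_right _ hx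
        rw [LinearMap.trace_eq_matrix_trace W (Pi.basisFun W _)] at hx0
        have := congrArg (algebraMap W k) hx0
        rw [map_zero] at this
        rw [← this, hred]
        exact (AddMonoidHom.map_trace (algebraMap W k) _).symm))
    exact isEndoTrivial_of_retraction σ r hr hr1 θW hθW
  · obtain ⟨F, hF⟩ := exists_monoidHom_matrix_lift hres hirr.ne_zero hϖ ρm l hl
      ((Fintype.card G : k)⁻¹ • LinearMap.id) (fun x hx ↦ by simp [hx])
      (fun x _ ↦ conjSum_smul_id _ (mul_inv_cancel₀ hG) x)
    refine ⟨_, _, _, _, isLiftOf_matrixRep ρ b F hF, ?_⟩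
    obtain ⟨c, hc⟩ := hunit (Fintype.card G) (by simpa using hG)
    obtain ⟨i⟩ := ‹Nonempty (Fin (Module.finrank k V))›
    -- The functional chosen is the `(i, i)` matrix entry, which takes the value `1` at the
    -- identity.
    exact isEndoTrivial_of_card_mul_eq_one _ hc
      (r := LinearMap.proj i ∘ₗ LinearMap.applyₗ (Pi.single i 1)) (by simp)
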